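/- \textbf{Setting.} Let $\mathbb{T}$ be a finite rooted tree. For a node $u$ write $\mathcal{C}_u$ for its set of children and $\mathbb{T}_u$ for the set consisting of $u$ and all its descendants. Let $(E_v,\mathcal{E}_v)_{v\in\mathbb{T}}$ be measurable spaces and set $$\boldsymbol{E}_u:=\prod_{v\in\mathbb{T}_u}E_v,\qquad \boldsymbol{E}_{\mathcal{C}_u}:=\prod_{v\in\mathbb{T}_u\setminus\{u\}}E_v=\prod_{v\in\mathcal{C}_u}\boldsymbol{E}_v,$$ with the product $\sigma$-algebras. For every node $u$ let $\rho_u$ be a finite measure on $\boldsymbol{E}_u$; for every non-leaf node $u$ let $\gamma_{u_-}$ be a finite measure on $\boldsymbol{E}_{\mathcal{C}_u}$ and $K_u$ a Markov kernel from $\boldsymbol{E}_{\mathcal{C}_u}$ to $E_u$; for every leaf $u$ let $K_u$ be a probability measure on $E_u$. Put $\gamma_u:=K_u$ if $u$ is a leaf, $\gamma_u(d\boldsymbol{x}_u):=\gamma_{u_-}(d\boldsymbol{x}_{\mathcal{C}_u})K_u(\boldsymbol{x}_{\mathcal{C}_u},dx_u)$ otherwise, and $\gamma_{\mathcal{C}_u}:=\prod_{v\in\mathcal{C}_u}\gamma_v$.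 Let $Z_u:=\rho_u(\boldsymbol{E}_u)$ and $\mu_u:=\rho_u/Z_u$. \textbf{Assumptions.} (1) For every node $u$, $\rho_u\ll\gamma_u$, and for every non-leaf node $u$, $\gamma_{u_-}\ll\gamma_{\mathcal{C}_u}$; versions $w_u=d\rho_u/d\gamma_u$ and $w_{u_-}=d\gamma_{u_-}/d\gamma_{\mathcal{C}_u}$ of the Radon--Nikodym derivatives that are positive everywhere are fixed. (2) These functions $w_u$ and $w_{u_-}$ are bounded. \textbf{Algorithm} $\mathrm{dac\_smc}(u)$ with $N\ge1$ particles. If $u$ is a leaf, draw $\boldsymbol{X}_u^{1,N},\dots,\boldsymbol{X}_u^{N,N}$ independently from $K_u$ and return $\gamma_u^N:=N^{-1}\sum_{n=1}^N\delta_{\boldsymbol{X}_u^{n,N}}$. Otherwise, run $\mathrm{dac\_smc}(v)$ (independently) for each $v\in\mathcal{C}_u$ to obtain $\gamma_v^N$; set $$\gamma_{u_-}^N(d\boldsymbol{x}):=w_{u_-}(\boldsymbol{x})\prod_{v\in\mathcal{C}_u}\gamma_v^N(d\boldsymbol{x}),\qquad \mathcal{Z}_u^N:=\gamma_{u_-}^N(\boldsymbol{E}_{\mathcal{C}_u}),\qquad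 \pi_{u_-}^N:=\gamma_{u_-}^N/\mathcal{Z}_u^N;$$ draw $\boldsymbol{X}_{u_-}^{1,N},\dots,\boldsymbol{X}_{u_-}^{N,N}$ independently from $\pi_{u_-}^N$; for each $n\le N$, draw $X_u^{n,N}$ independently from $K_u(\boldsymbol{X}_{u_-}^{n,N},\cdot)$ and set $\boldsymbol{X}_u^{n,N}:=(X_u^{n,N},\boldsymbol{X}_{u_-}^{n,N})$; return $\gamma_u^N:=N^{-1}\mathcal{Z}_u^N\sum_{n=1}^N\delta_{\boldsymbol{X}_u^{n,N}}$. From the output define $$\rho_u^N(d\boldsymbol{x}_u):=w_u(\boldsymbol{x}_u)\gamma_u^N(d\boldsymbol{x}_u),\qquad Z_u^N:=\rho_u^N(\boldsymbol{E}_u),\qquad \mu_u^N:=\rho_u^N/Z_u^N .$$ \textbf{Theorem (Strong laws of large numbers).} Let Assumptions (1) and (2) hold, let $u\in\mathbb{T}$, let $\varphi:\boldsymbol{E}_u\to\mathbb{R}$ be bounded and measurable, and let the outputs of $\mathrm{dac\_smc}(u)$ for all $N\ge1$ be defined on a common probability space (with an arbitrary joint law across different $N$). Then, almost surely, as $N\to\infty$,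 $$\rho_u^N(\varphi)\to\rho_u(\varphi),\qquad \mu_u^N(\varphi)\to\mu_u(\varphi),\qquad Z_u^N\to Z_u .$$ -/

import Mathlib

open MeasureTheory ProbabilityTheory Filter Topology
open scoped ENNReal NNReal

namespace DaCSMC

universe u v

/-! A finite rooted tree is a `RootedTree` `T` with `[Finite T]`: `a ≤ b` means that `a` is `b` or an
ancestor of `b`, the root is `⊥`, a leaf is a maximal node, and `a ⋖ b` means that `b` is a child
of `a`. The node `a` together with its descendants is `Set.Ici a`, the descendants alone form
`Set.Ioi a`. -/

section Spaces

variable {T : RootedTree.{u}} (E : T → Type v)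

/-- The product of the spaces indexed by `a` and all its descendants. -/
abbrev FullSpace (a : T) : Type max u v := ∀ b : Set.Ici a, E b

/-- The product of the spaces indexed by the (strict) descendants of `a`. For a leaf this is a
one-point space. -/
abbrev ChildrenSpace (a : T) : Type max u v := ∀ b : Set.Ioi a, E b

/-- The set of children of a node. -/
abbrev Child (a : T) : Type u := {c : T // a ⋖ c}

noncomputable instance [Finite T] (a : T) : Fintype (Child a) := Fintype.ofFinite _

variable {E}

theorem exists_child_le [Finite T] {a : T} (b : Set.Ioi a) : ∃ c : Child a, c.1 ≤ b.1 := by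
  have : WellFoundedLT T := Finite.to_wellFoundedLT
  obtain ⟨c, hc, hcb⟩ := exists_covBy_le_of_lt (show a < b.1 from b.2)
  exact ⟨⟨c, hc⟩, hcb⟩

/-- The (unique) child of `a` whose subtree contains the descendant `b` of `a`. -/
noncomputable def childToward [Finite T] {a : T} (b : Set.Ioi a) : Child a :=
  (exists_child_le b).choose

theorem childToward_le [Finite T] {a : T} (b : Set.Ioi a) : (childToward b).1 ≤ b.1 :=
  (exists_child_le b).choose_spec

/-- The identification of the product over the children `c` of `a` of the spaces `FullSpace E c`
with `ChildrenSpace E a`. -/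
noncomputable def concat [Finite T] (a : T) (x : ∀ c : Child a, FullSpace E c.1) :
    ChildrenSpace E a :=
  fun b => x (childToward b) ⟨b.1, childToward_le b⟩

open Classical in
/-- The identification of `ChildrenSpace E a × E a` with `FullSpace E a`. -/
noncomputable def glue (a : T) (p : ChildrenSpace E a × E a) : FullSpace E a :=
  fun b => if h : a = b.1 then h ▸ p.2 else p.1 ⟨b.1, lt_of_le_of_ne b.2 h⟩

/-- The only point of the empty product `ChildrenSpace E a`, for a leaf `a`. -/
def leafPoint {a : T} (h : IsMax a) : ChildrenSpace E a :=
  fun b => absurd b.2 h.not_lt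

end Spaces

/-- `w` is a version of the Radon-Nikodym derivative `dν/dμ`. -/
def IsRNDeriv {S : Type*} [MeasurableSpace S] (w : S → ℝ≥0) (ν μ : Measure S) : Prop :=
  Measurable w ∧ ν = μ.withDensity fun x => (w x : ℝ≥0∞)

/-- The measure `(z / N) ∑ₙ δ_{xₙ}`. -/
noncomputable def particleMeasure {S : Type*} [MeasurableSpace S] {N : ℕ} (z : ℝ≥0)
    (x : Fin N → S) : Measure S :=
  (z / (N : ℝ≥0)) • ∑ n, Measure.dirac (x n)

/-- The normalization of a (non-zero, finite) measure. -/
noncomputable def normalize {S : Type*} [MeasurableSpace S] (μ : Measure S) : Measure S :=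
  (μ Set.univ)⁻¹ • μ

/-- The ingredients of the algorithm: target measures `ρ`, auxiliary measures `auxM`, proposal
kernels `K`, and versions `w`, `wAux` of the weight functions.
The auxiliary measure and the auxiliary weight function are only meaningful at the nodes that are
not leaves (their values at the leaves are never used). For a leaf `a`, `K a` is a kernel from a
one-point space, that is, a probability distribution on `E a`. -/
structure Model (T : RootedTree.{u}) (E : T → Type v) [∀ a, MeasurableSpace (E a)] where
  ρ : ∀ a : T, Measure (FullSpace E a)
  auxM : ∀ a : T, Measure (ChildrenSpace E a)
  K : ∀ a : T, Kernel (ChildrenSpace E a) (E a)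
  w : ∀ a : T, FullSpace E a → ℝ≥0
  wAux : ∀ a : T, ChildrenSpace E a → ℝ≥0
  finite_ρ : ∀ a, IsFiniteMeasure (ρ a)
  finite_auxM : ∀ a, ¬ IsMax a → IsFiniteMeasure (auxM a)
  markov_K : ∀ a, IsMarkovKernel (K a)

namespace Model

variable {T : RootedTree.{u}} {E : T → Type v} [∀ a, MeasurableSpace (E a)] (M : Model T E)

/-- The proposal distribution at a leaf. -/
noncomputable def leafProposal {a : T} (h : IsMax a) : Measure (FullSpace E a) :=
  (M.K a (leafPoint h)).map fun y => glue a (leafPoint h, y)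

open Classical in
/-- The extended auxiliary measure at `a`: the outer product of the auxiliary measure and
the proposal kernel, or the proposal distribution if `a` is a leaf. -/
noncomputable def extM (a : T) : Measure (FullSpace E a) :=
  if h : IsMax a then M.leafProposal h
  else ((M.auxM a).compProd (M.K a)).map (glue a)

/-- The product of the extended auxiliary measures of the children of `a`. -/
noncomputable def prodChildren [Finite T] (a : T) : Measure (ChildrenSpace E a) :=
  (Measure.pi fun c : Child a => M.extM c.1).map (concat a)

/-- Absolute continuity, with weight functions (Radon-Nikodym derivatives) that are positive
everywhere. -/
structure AbsContPositive [Finite T] : Prop where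
  ac : ∀ a, M.ρ a ≪ M.extM a
  deriv : ∀ a, IsRNDeriv (M.w a) (M.ρ a) (M.extM a)
  pos : ∀ a x, 0 < M.w a x
  acAux : ∀ a, ¬ IsMax a → M.auxM a ≪ M.prodChildren a
  derivAux : ∀ a, ¬ IsMax a → IsRNDeriv (M.wAux a) (M.auxM a) (M.prodChildren a)
  posAux : ∀ a, ¬ IsMax a → ∀ x, 0 < M.wAux a x

/-- The weight functions are bounded. -/
structure BoundedWeights : Prop where
  bdd : ∀ a, ∃ C, ∀ x, M.w a x ≤ C
  bddAux : ∀ a, ¬ IsMax a → ∃ C, ∀ x, M.wAux a x ≤ C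

/-- The normalized target. -/
noncomputable def μ (a : T) : Measure (FullSpace E a) := normalize (M.ρ a)

/-- The correction step at `a`: given the outputs `(z, x)` of the recursive calls at the children
of `a`, the product of the corresponding particle measures reweighted by the auxiliary weight
function of `a`. -/
noncomputable def auxMN [Finite T] {N : ℕ} (a : T)
    (out : ∀ c : Child a, ℝ≥0 × (Fin N → FullSpace E c.1)) : Measure (ChildrenSpace E a) :=
  ((Measure.pi fun c => particleMeasure (out c).1 (out c).2).map (concat a)).withDensity
    fun x => (M.wAux a x : ℝ≥0∞)

/-- The mutation step at `a`: the law of the extended particles given the resampled ones. -/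
noncomputable def mutate {N : ℕ} (a : T) (y : Fin N → ChildrenSpace E a) :
    Measure (Fin N → FullSpace E a) :=
  Measure.pi fun n => (M.K a (y n)).map fun t => glue a (y n, t)

open Classical in
/-- The law of the output of the divide-and-conquer SMC algorithm with `N` particles called
on the node `a`. The output is a pair `(z, x)` with `z` the mass and `x` the particles; it encodes
the particle approximation `particleMeasure z x` of the extended auxiliary measure.
* At a leaf, `N` independent particles are drawn from the proposal distribution and the mass is `1`.
* Otherwise, the algorithm is called (independently) on each child of `a`, the product of the
  returned particle measures is reweighted, `N` independent particles are drawn from the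
  normalized result and then extended independently using the proposal kernel; the mass is that of
  the reweighted measure. -/
noncomputable def dacSMC [Finite T] (N : ℕ) (a : T) :
    Measure (ℝ≥0 × (Fin N → FullSpace E a)) :=
  if h : IsMax a then
    (Measure.pi fun _ : Fin N => M.leafProposal h).map fun x => (1, x)
  else
    (Measure.pi fun c : Child a => dacSMC N c.1).bind fun out =>
      (Measure.pi fun _ : Fin N => normalize (M.auxMN a out)).bind fun y =>
        (M.mutate a y).map fun x => ((M.auxMN a out Set.univ).toNNReal, x)
termination_by (Set.Ioi a).ncard
decreasing_by
  exact Set.ncard_lt_ncard (Set.Ioi_ssubset_Ioi c.2.lt) (Set.toFinite _)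

/-- The approximation of the target `ρ a` obtained from an output of the algorithm. -/
noncomputable def ρN {N : ℕ} (a : T) (out : ℝ≥0 × (Fin N → FullSpace E a)) :
    Measure (FullSpace E a) :=
  (particleMeasure out.1 out.2).withDensity fun x => (M.w a x : ℝ≥0∞)

/-- The approximation of the normalized target `μ a` obtained from an output of the algorithm. -/
noncomputable def μN {N : ℕ} (a : T) (out : ℝ≥0 × (Fin N → FullSpace E a)) :
    Measure (FullSpace E a) :=
  normalize (M.ρN a out)

end Model

end DaCSMC

/-!
The algorithm is analysed through the tail probabilities of the errors `γᴺ(φ) - γ(φ)`, where `γᴺ` is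
the particle measure returned at a node and `γ` the extended auxiliary measure of that node. The
joint law across different `N` being arbitrary, almost sure convergence is obtained from the
Borel–Cantelli lemma, so these probabilities have to be summable in `N`. The property that is proved
by induction over the tree, from the leaves to the root, is `UniformCompleteConv`: for every
`ε > 0` and `B > 0` the probabilities of an error of at least `ε` are at most `δ N`, with a
summable `δ` that is the same for all measurable `φ` bounded by `B`.

At a leaf this is Hoeffding's inequality (`hoeffding_pi`). At an inner node there are two errors.

* The product of the particle measures of the children differs from the product of their limits.
  The factors are replaced one at a time (`measure_hybrid_insert_le`,
  `measure_pi_particleMeasure_le`). Conditionally on the other particles, the replacement of one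
  factor changes the integral of `f` by the error of that factor for the function obtained from `f`
  by integrating out the other coordinates. That function is random but independent of the factor,
  and its bound is deterministic because the masses are bounded; this is where the uniformity in `φ`
  is used. As the auxiliary weights are bounded, the error carries over to the reweighted product.
* Given the outputs of the children, the new particles are independent and identically
  distributed (`Model.stepLaw_eq_map_pi`, by `pi_bind_pi`), and the mass of the reweighted measure
  cancels its normalization (`Model.mass_mul_integral_normalize`), so Hoeffding's inequality applies
  again (`Model.stepLaw_deviation_le`).

Positivity of the weights keeps the masses positive, so that the normalizations are
probability measures, and makes the limiting masses non-zero. The laws for the targets follow by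
applying the convergence to `w * φ` and to `w`.
-/

namespace DaCSMC

/-! ### Measurable families of measures and finite products -/

section Products

variable {ι : Type*} [Fintype ι] {X : ι → Type*} [∀ i, MeasurableSpace (X i)]

theorem measurable_measure_pi {α : Type*} [MeasurableSpace α] {m : ∀ i, α → Measure (X i)}
    (hm : ∀ i, Measurable (m i)) [∀ i a, IsFiniteMeasure (m i a)] :
    Measurable fun a => Measure.pi fun i => m i a := by
  refine Measurable.measure_of_isPiSystem generateFrom_pi.symm isPiSystem_pi ?_ ?_
  · rintro _ ⟨s, hs, rfl⟩
    simp only [Measure.pi_pi]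
    exact Finset.measurable_prod _ fun i _ =>
      (Measure.measurable_coe (hs i (Set.mem_univ i))).comp (hm i)
  · simp only [Measure.pi_univ]
    exact Finset.measurable_prod _ fun i _ => (Measure.measurable_coe .univ).comp (hm i)

theorem integrable_of_abs_le {S : Type*} [MeasurableSpace S] {μ : Measure S} [IsFiniteMeasure μ]
    {f : S → ℝ} (hf : Measurable f) {B : ℝ} (hB : ∀ x, |f x| ≤ B) : Integrable f μ :=
  Integrable.of_bound hf.aestronglyMeasurable B (ae_of_all _ hB)

theorem measurable_integral_of_abs_le {α S : Type*} [MeasurableSpace α] [MeasurableSpace S]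
    {m : α → Measure S} (hm : Measurable m) [∀ a, IsFiniteMeasure (m a)]
    {f : S → ℝ} (hf : Measurable f) {B : ℝ} (hB : ∀ x, |f x| ≤ B) :
    Measurable fun a => ∫ x, f x ∂(m a) := by
  have h : ∀ a, ∫ x, f x ∂(m a) =
      (∫⁻ x, ENNReal.ofReal (f x) ∂(m a)).toReal - (∫⁻ x, ENNReal.ofReal (-f x) ∂(m a)).toReal :=
    fun a => integral_eq_lintegral_pos_part_sub_lintegral_neg_part (integrable_of_abs_le hf hB)
  simp only [h]
  exact ((Measure.measurable_lintegral hf.ennreal_ofReal).comp hm).ennreal_toReal.sub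
    ((Measure.measurable_lintegral hf.neg.ennreal_ofReal).comp hm).ennreal_toReal

/-- The probability measure `ν c` is forgotten: this isolates the integration over one
coordinate of a product measure without splitting the index type. -/
theorem map_update_prod_pi [DecidableEq ι] {μ ν : ∀ i, Measure (X i)}
    [∀ i, IsFiniteMeasure (μ i)] [∀ i, IsFiniteMeasure (ν i)] {c : ι} (hc : ν c Set.univ = 1)
    (h : ∀ i, i ≠ c → ν i = μ i) :
    ((Measure.pi ν).prod (μ c)).map (fun p => Function.update p.1 c p.2) = Measure.pi μ := by
  have hmeas : Measurable fun p : (∀ i, X i) × X c => Function.update p.1 c p.2 :=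
    measurable_update'
  refine (Measure.pi_eq fun s hs => ?_).symm
  rw [Measure.map_apply hmeas (MeasurableSet.univ_pi hs)]
  have : (fun p : (∀ i, X i) × X c => Function.update p.1 c p.2) ⁻¹' Set.univ.pi s =
      (Set.univ.pi (Function.update s c Set.univ)) ×ˢ s c := by
    ext p
    simp only [Set.mem_preimage, Set.mem_pi, Set.mem_univ, true_imp_iff, Set.mem_prod]
    constructor
    · refine fun hp => ⟨fun i => ?_, by simpa using hp c⟩
      by_cases hi : i = c
      · subst hi; simp
      · simpa [hi] using hp i
    · rintro ⟨hp, hp'⟩ i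
      by_cases hi : i = c
      · subst hi; simpa using hp'
      · simpa [hi] using hp i
  rw [this, Measure.prod_prod, Measure.pi_pi, ← Finset.mul_prod_erase _ _ (Finset.mem_univ c),
    ← Finset.mul_prod_erase Finset.univ (fun i => μ i (s i)) (Finset.mem_univ c)]
  simp only [Function.update_self, hc, one_mul]
  rw [mul_comm]
  congr 1
  refine Finset.prod_congr rfl fun i hi => ?_
  have hi' := Finset.ne_of_mem_erase hi
  rw [Function.update_of_ne hi', h i hi']

/-- Independent draws followed by independent transitions are independent draws from the
compositions. -/
theorem pi_bind_pi {Y : ι → Type*} [∀ i, MeasurableSpace (Y i)] {m : ∀ i, Measure (X i)}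
    [∀ i, IsProbabilityMeasure (m i)] {κ : ∀ i, X i → Measure (Y i)} (hκ : ∀ i, Measurable (κ i))
    [∀ i x, IsProbabilityMeasure (κ i x)] :
    ((Measure.pi m).bind fun x => Measure.pi fun i => κ i (x i)) =
      Measure.pi fun i => (m i).bind (κ i) := by
  have hκ' : ∀ i, Measurable fun x : ∀ i, X i => κ i (x i) :=
    fun i => (hκ i).comp (measurable_pi_apply i)
  have hpi : Measurable fun x : ∀ i, X i => Measure.pi fun i => κ i (x i) :=
    measurable_measure_pi hκ'
  have : ∀ i, IsProbabilityMeasure ((m i).bind (κ i)) := fun i =>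
    isProbabilityMeasure_bind (hκ i).aemeasurable (ae_of_all _ inferInstance)
  refine (Measure.pi_eq fun s hs => ?_).symm
  rw [Measure.bind_apply (MeasurableSet.univ_pi hs) hpi.aemeasurable]
  simp only [Measure.pi_pi]
  have hf : ∀ i, Measurable fun x => κ i x (s i) :=
    fun i => (Measure.measurable_coe (hs i)).comp (hκ i)
  have key := lintegral_prod_eq_prod_lintegral_of_indepFun (μ := Measure.pi m) Finset.univ
    (fun i x => κ i (x i) (s i)) (iIndepFun_pi (X := fun i x => κ i x (s i))
      fun i => (hf i).aemeasurable) fun i => (hf i).comp (measurable_pi_apply i)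
  rw [key]
  refine Finset.prod_congr rfl fun i _ => ?_
  rw [Measure.bind_apply (hs i) (hκ i).aemeasurable]
  exact (measurePreserving_eval m i).lintegral_comp (hf i)

end Products

/-! ### Hoeffding's inequality for empirical means -/

theorem hoeffding_pi {S : Type*} [MeasurableSpace S] (Q : Measure S) [IsProbabilityMeasure Q]
    {N : ℕ} (hN : 0 < N) {φ : S → ℝ} (hφ : Measurable φ) {B : ℝ} (hB : 0 < B)
    (hφB : ∀ x, |φ x| ≤ B) {ε : ℝ} (hε : 0 < ε) :
    (Measure.pi fun _ : Fin N => Q) {x | ε ≤ |(N : ℝ)⁻¹ * ∑ n, φ (x n) - ∫ y, φ y ∂Q|} ≤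
      ENNReal.ofReal (2 * Real.exp (-(N * (ε ^ 2 / (2 * B ^ 2))))) := by
  have hN' : (0 : ℝ) < N := Nat.cast_pos.2 hN
  -- The one-sided bound, applied below to `φ` and to `-φ`.
  have one : ∀ ψ : S → ℝ, Measurable ψ → (∀ x, |ψ x| ≤ B) →
      (Measure.pi fun _ : Fin N => Q).real {x | N * ε ≤ ∑ n, (ψ (x n) - ∫ y, ψ y ∂Q)} ≤
        Real.exp (-(N * (ε ^ 2 / (2 * B ^ 2)))) := by
    intro ψ hψ hψB
    have hsub : ∀ n : Fin N, HasSubgaussianMGF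
        (fun x : Fin N → S => ψ (x n) - ∫ y, ψ y ∂Q) ((‖B - -B‖₊ / 2) ^ 2)
        (Measure.pi fun _ : Fin N => Q) := by
      intro n
      have := hasSubgaussianMGF_of_mem_Icc (μ := Measure.pi fun _ : Fin N => Q)
        (X := fun x : Fin N → S => ψ (x n)) (a := -B) (b := B)
        (hψ.comp (measurable_pi_apply n)).aemeasurable
        (ae_of_all _ fun x => abs_le.1 (hψB (x n)))
      have h2 : ∫ x : Fin N → S, ψ (x n) ∂(Measure.pi fun _ : Fin N => Q) = ∫ y, ψ y ∂Q := by
        have h3 := (measurePreserving_eval (fun _ : Fin N => Q) n)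
        conv_rhs => rw [← h3.map_eq]
        exact (integral_map h3.measurable.aemeasurable hψ.aestronglyMeasurable).symm
      rwa [h2] at this
    have key := HasSubgaussianMGF.measure_sum_ge_le_of_iIndepFun
      (iIndepFun_pi (μ := fun _ : Fin N => Q) (X := fun _ y => ψ y - ∫ y, ψ y ∂Q)
        fun _ => (hψ.sub_const _).aemeasurable)
      (s := Finset.univ) (fun n _ => hsub n) (ε := N * ε) (by positivity)
    refine key.trans (le_of_eq ?_)
    congr 1
    have hBB : ‖B - -B‖ / 2 = B := by
      rw [Real.norm_eq_abs, abs_of_pos (by linarith)]; ring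
    simp only [Finset.sum_const, Finset.card_univ, Fintype.card_fin, nsmul_eq_mul, NNReal.coe_mul,
      NNReal.coe_natCast, NNReal.coe_pow, NNReal.coe_div, coe_nnnorm, NNReal.coe_ofNat, hBB]
    field_simp
  have hsubset : {x : Fin N → S | ε ≤ |(N : ℝ)⁻¹ * ∑ n, φ (x n) - ∫ y, φ y ∂Q|} ⊆
      {x | N * ε ≤ ∑ n, (φ (x n) - ∫ y, φ y ∂Q)} ∪
      {x | N * ε ≤ ∑ n, (-φ (x n) - ∫ y, -φ y ∂Q)} := by
    intro x hx
    simp only [Set.mem_ofPred_eq, Set.mem_union, Finset.sum_sub_distrib, Finset.sum_const,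
      Finset.card_univ, Fintype.card_fin, nsmul_eq_mul, integral_neg, Finset.sum_neg_distrib]
      at hx ⊢
    have hx2 : N * ε ≤ |∑ n, φ (x n) - N * ∫ y, φ y ∂Q| := by
      have : ∑ n, φ (x n) - N * ∫ y, φ y ∂Q =
          N * ((N : ℝ)⁻¹ * ∑ n, φ (x n) - ∫ y, φ y ∂Q) := by field_simp
      rw [this, abs_mul, abs_of_pos hN']
      gcongr
    rcases le_abs.1 hx2 with h | h
    · exact Or.inl h
    · right; linarith
  rw [← ofReal_measureReal]
  refine ENNReal.ofReal_le_ofReal ((measureReal_mono hsubset).trans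
    ((measureReal_union_le _ _).trans ?_))
  have h1 := one φ hφ hφB
  have h2 := one (fun x => -φ x) hφ.neg (by simpa using hφB)
  linarith

theorem tsum_exp_bound_ne_top {c : ℝ} (hc : 0 < c) :
    ∑' N : ℕ, ENNReal.ofReal (2 * Real.exp (-(N * c))) ≠ ∞ := by
  have h : Summable fun N : ℕ => 2 * Real.exp (-(N * c)) := by
    refine Summable.mul_left _ ?_
    simpa [mul_comm] using Real.summable_exp_nat_mul_iff.2 (neg_lt_zero.2 hc)
  rw [← ENNReal.ofReal_tsum_of_nonneg (fun N => by positivity) h]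
  exact ENNReal.ofReal_ne_top

/-! ### Particle measures and uniform complete convergence -/

section Particle

variable {S : Type*} [MeasurableSpace S]

instance isFiniteMeasure_particleMeasure {N : ℕ} (z : ℝ≥0) (x : Fin N → S) :
    IsFiniteMeasure (particleMeasure z x) := by
  unfold particleMeasure; infer_instance

theorem particleMeasure_univ {N : ℕ} (hN : 0 < N) (z : ℝ≥0) (x : Fin N → S) :
    particleMeasure z x Set.univ = z := by
  have hN' : (N : ℝ≥0) ≠ 0 := by exact_mod_cast hN.ne'
  have h : particleMeasure z x Set.univ = ((z / N : ℝ≥0) : ℝ≥0∞) * ((N : ℝ≥0) : ℝ≥0∞) := by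
    rw [particleMeasure, Measure.smul_apply, Measure.finsetSum_apply]
    simp [-Measure.coe_nnreal_smul, ENNReal.smul_def]
  rw [h, ← ENNReal.coe_mul, div_mul_cancel₀ _ hN']

theorem integral_particleMeasure {N : ℕ} (z : ℝ≥0) (x : Fin N → S) {φ : S → ℝ}
    (hφ : Measurable φ) :
    ∫ y, φ y ∂(particleMeasure z x) = z * ((N : ℝ)⁻¹ * ∑ n, φ (x n)) := by
  have h : ∀ n ∈ (Finset.univ : Finset (Fin N)), Integrable φ (Measure.dirac (x n)) :=
    fun n _ => integrable_dirac' hφ.stronglyMeasurable (by simp)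
  rw [particleMeasure, integral_smul_nnreal_measure, integral_finsetSum_measure h]
  simp only [integral_dirac' _ _ hφ.stronglyMeasurable, NNReal.smul_def, smul_eq_mul,
    NNReal.coe_div, NNReal.coe_natCast]
  ring

theorem measurable_particleMeasure {N : ℕ} :
    Measurable fun o : ℝ≥0 × (Fin N → S) => particleMeasure o.1 o.2 := by
  refine Measure.measurable_of_measurable_coe _ fun s hs => ?_
  simp only [particleMeasure, Measure.smul_apply, Measure.finsetSum_apply, ENNReal.smul_def,
    smul_eq_mul]
  have h : ∀ n, Measurable fun o : ℝ≥0 × (Fin N → S) => Measure.dirac (o.2 n) s := fun n =>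
    (Measure.measurable_coe hs).comp
      (Measure.measurable_dirac.comp ((measurable_pi_apply n).comp measurable_snd))
  exact (measurable_fst.div_const _).coe_nnreal_ennreal.mul
    (Finset.measurable_sum _ fun n _ => h n)

/-- The random particle measures with `N` particles, distributed according to `P N`, converge to
`γ` completely (the probabilities of a given deviation are summable in `N`) when integrated
against a bounded measurable function, and the summable bound depends only on a bound `B` of that
function. The uniformity in the function allows it to depend on other, independent particles. -/
def UniformCompleteConv (P : ∀ N : ℕ, Measure (ℝ≥0 × (Fin N → S))) (γ : Measure S) : Prop :=
  ∀ B : ℝ, 0 < B → ∀ ε : ℝ, 0 < ε → ∃ δ : ℕ → ℝ≥0∞, ∑' N, δ N ≠ ∞ ∧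
    ∀ N, 0 < N → ∀ φ : S → ℝ, Measurable φ → (∀ x, |φ x| ≤ B) →
      P N {o | ε ≤ |∫ x, φ x ∂(particleMeasure o.1 o.2) - ∫ x, φ x ∂γ|} ≤ δ N

end Particle

section Hybrid

variable {ι : Type*} [DecidableEq ι] {S : ι → Type*} [∀ i, MeasurableSpace (S i)]

/-- The factors of the product measure in which the limits `γ i` have been replaced by
particle measures for `i ∈ s`. -/
noncomputable def hybrid {N : ℕ} (γ : ∀ i, Measure (S i)) (s : Finset ι)
    (o : ∀ i, ℝ≥0 × (Fin N → S i)) (i : ι) : Measure (S i) :=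
  if i ∈ s then particleMeasure (o i).1 (o i).2 else γ i

variable {γ : ∀ i, Measure (S i)}

theorem measurable_hybrid {N : ℕ} (s : Finset ι) (i : ι) :
    Measurable fun o : ∀ i, ℝ≥0 × (Fin N → S i) => hybrid γ s o i := by
  unfold hybrid
  split_ifs
  · exact measurable_particleMeasure.comp (measurable_pi_apply i)
  · exact measurable_const

theorem hybrid_update_of_notMem {N : ℕ} {s : Finset ι} {c : ι} (hc : c ∉ s)
    (o : ∀ i, ℝ≥0 × (Fin N → S i)) (t : ℝ≥0 × (Fin N → S c)) :
    hybrid γ s (Function.update o c t) = hybrid γ s o := by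
  funext i
  unfold hybrid
  split_ifs with h
  · rw [Function.update_of_ne (ne_of_mem_of_not_mem h hc)]
  · rfl

variable [∀ i, IsFiniteMeasure (γ i)]

instance isFiniteMeasure_hybrid {N : ℕ} (s : Finset ι) (o : ∀ i, ℝ≥0 × (Fin N → S i)) (i : ι) :
    IsFiniteMeasure (hybrid γ s o i) := by
  unfold hybrid; split_ifs <;> infer_instance

variable [Fintype ι]

theorem measurable_pi_hybrid {N : ℕ} (s : Finset ι) :
    Measurable fun o : ∀ i, ℝ≥0 × (Fin N → S i) => Measure.pi (hybrid γ s o) :=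
  measurable_measure_pi fun i => measurable_hybrid s i

/-- Integration with respect to a product measure `Measure.pi μ`, with the coordinate `c` last.
The measure `ν` only serves to integrate over the other coordinates. -/
theorem integral_pi_eq_integral_update {μ ν : ∀ i, Measure (S i)}
    [∀ i, IsFiniteMeasure (μ i)] [∀ i, IsFiniteMeasure (ν i)] {c : ι} (hc : ν c Set.univ = 1)
    (h : ∀ i, i ≠ c → ν i = μ i) {f : (∀ i, S i) → ℝ} (hf : Measurable f) {B : ℝ}
    (hB : ∀ x, |f x| ≤ B) :
    ∫ x, f x ∂(Measure.pi μ) =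
      ∫ t, ∫ x, f (Function.update x c t) ∂(Measure.pi ν) ∂(μ c) := by
  have hu : Measurable fun p : (∀ i, S i) × S c => Function.update p.1 c p.2 :=
    measurable_update'
  rw [← map_update_prod_pi hc h, integral_map hu.aemeasurable hf.aestronglyMeasurable]
  exact integral_prod_symm _ (integrable_of_abs_le (hf.comp hu) fun p => hB _)

/-- The telescoping step in the comparison of products of particle measures with the product of
their limits. Conditionally on the particles of the coordinates other than `c`, the difference is
an error of the particle measure at `c` for the function obtained by integrating out the
other coordinates; that function is bounded by `B * D`. -/
theorem measure_hybrid_insert_le {N : ℕ} (hN : 0 < N) [∀ i, Nonempty (S i)]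
    {P : ∀ i, Measure (ℝ≥0 × (Fin N → S i))} [∀ i, IsProbabilityMeasure (P i)]
    {C : ι → ℝ≥0} (hC : ∀ i, ∀ᵐ o ∂(P i), o.1 ≤ C i) {c : ι} {s : Finset ι} (hcs : c ∉ s)
    {B ε : ℝ} {D : ℝ} (hBpos : 0 < B)
    (hD : ∏ i, max 1 (max (C i : ℝ) ((γ i).real Set.univ)) ≤ D) {δ : ℝ≥0∞}
    (hδ : ∀ φ : S c → ℝ, Measurable φ → (∀ x, |φ x| ≤ B * D) →
      P c {o | ε ≤ |∫ x, φ x ∂(particleMeasure o.1 o.2) - ∫ x, φ x ∂(γ c)|} ≤ δ)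
    {f : (∀ i, S i) → ℝ} (hf : Measurable f) (hB : ∀ x, |f x| ≤ B) :
    Measure.pi P {o | ε ≤ |∫ x, f x ∂(Measure.pi (hybrid γ (insert c s) o)) -
      ∫ x, f x ∂(Measure.pi (hybrid γ s o))|} ≤ δ := by
  have hmeas : MeasurableSet {o : ∀ i, ℝ≥0 × (Fin N → S i) |
      ε ≤ |∫ x, f x ∂(Measure.pi (hybrid γ (insert c s) o)) -
        ∫ x, f x ∂(Measure.pi (hybrid γ s o))|} :=
    measurableSet_le measurable_const
      (((measurable_integral_of_abs_le (measurable_pi_hybrid _) hf hB).sub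
        (measurable_integral_of_abs_le (measurable_pi_hybrid _) hf hB)).norm)
  have hu : Measurable fun p : (∀ i, ℝ≥0 × (Fin N → S i)) × (ℝ≥0 × (Fin N → S c)) =>
      Function.update p.1 c p.2 := measurable_update'
  -- Redraw the output at `c` independently of everything else.
  rw [← map_update_prod_pi (μ := P) (ν := P) (c := c) measure_univ fun _ _ => rfl,
    Measure.map_apply hu hmeas, Measure.prod_apply (hu hmeas)]
  refine (lintegral_mono_ae (g := fun _ => δ) ?_).trans (by simp)
  have hall : ∀ᵐ o ∂(Measure.pi P), ∀ i, (o i).1 ≤ C i :=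
    eventually_all.2 fun i => (Measure.quasiMeasurePreserving_eval P i).ae (hC i)
  filter_upwards [hall] with o ho
  obtain ⟨p₀⟩ : Nonempty (S c) := inferInstance
  set ν : ∀ i, Measure (S i) := Function.update (hybrid γ s o) c (Measure.dirac p₀) with hν
  have hνfin : ∀ i, IsFiniteMeasure (ν i) := by
    intro i
    by_cases hi : i = c
    · subst hi; rw [hν, Function.update_self]; infer_instance
    · rw [hν, Function.update_of_ne hi]; infer_instance
  have hνc : ν c Set.univ = 1 := by simp [hν]
  have hνmass : (Measure.pi ν).real Set.univ ≤ D := by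
    refine le_trans ?_ hD
    rw [measureReal_def, Measure.pi_univ, ENNReal.toReal_prod]
    refine Finset.prod_le_prod (fun _ _ => ENNReal.toReal_nonneg) fun i _ => ?_
    by_cases hi : i = c
    · subst hi; rw [hνc]; simp
    · rw [hν, Function.update_of_ne hi, hybrid]
      split_ifs
      · rw [particleMeasure_univ hN]
        exact le_max_of_le_right (le_max_of_le_left (by exact_mod_cast ho i))
      · exact le_max_of_le_right (le_max_right _ _)
  let g : S c → ℝ := fun t => ∫ x, f (Function.update x c t) ∂(Measure.pi ν)
  have hg : Measurable g := by
    have h1 : StronglyMeasurable fun p : S c × (∀ i, S i) => f (Function.update p.2 c p.1) :=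
      (hf.comp (measurable_update'.comp measurable_swap)).stronglyMeasurable
    exact h1.integral_prod_right.measurable
  have hgB : ∀ t, |g t| ≤ B * D := fun t =>
    (norm_integral_le_of_norm_le_const (f := fun x => f (Function.update x c t))
      (ae_of_all _ fun x => hB _)).trans
      (mul_le_mul_of_nonneg_left hνmass hBpos.le)
  refine le_trans (le_of_eq ?_) (hδ g hg hgB)
  congr 1
  ext t
  have e1 : ∫ x, f x ∂(Measure.pi (hybrid γ (insert c s) (Function.update o c t))) =
      ∫ y, g y ∂(particleMeasure t.1 t.2) := by
    rw [integral_pi_eq_integral_update (ν := ν) hνc (fun i hi => ?_) hf hB]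
    · simp [hybrid, g]
    · rw [hν, Function.update_of_ne hi]
      simp [hybrid, hi]
  have e2 : ∫ x, f x ∂(Measure.pi (hybrid γ s (Function.update o c t))) =
      ∫ y, g y ∂(γ c) := by
    rw [hybrid_update_of_notMem hcs,
      integral_pi_eq_integral_update (ν := ν) hνc (fun i hi => ?_) hf hB]
    · simp [hybrid, hcs, g]
    · rw [hν, Function.update_of_ne hi]
  simp only [Set.mem_preimage, Set.mem_ofPred_eq, e1, e2]

/-- Products of independent particle measures with bounded masses converge completely to the
product of their limits, uniformly over bounded measurable functions on the product space. -/
theorem measure_pi_particleMeasure_le [∀ i, Nonempty (S i)]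
    {P : ∀ i, ∀ N : ℕ, Measure (ℝ≥0 × (Fin N → S i))}
    (hP : ∀ i N, 0 < N → IsProbabilityMeasure (P i N)) {C : ι → ℝ≥0}
    (hC : ∀ i N, 0 < N → ∀ᵐ o ∂(P i N), o.1 ≤ C i)
    (hconv : ∀ i, UniformCompleteConv (P i) (γ i)) {B : ℝ} (hB : 0 < B) {ε : ℝ} (hε : 0 < ε) :
    ∃ δ : ℕ → ℝ≥0∞, ∑' N, δ N ≠ ∞ ∧ ∀ N, 0 < N → ∀ f : (∀ i, S i) → ℝ, Measurable f →
      (∀ x, |f x| ≤ B) → Measure.pi (fun i => P i N)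
        {o | ε ≤ |∫ x, f x ∂(Measure.pi fun i => particleMeasure (o i).1 (o i).2) -
          ∫ x, f x ∂(Measure.pi γ)|} ≤ δ N := by
  have key : ∀ s : Finset ι, ∀ ε : ℝ, 0 < ε →
      ∃ δ : ℕ → ℝ≥0∞, ∑' N, δ N ≠ ∞ ∧ ∀ N, 0 < N → ∀ f : (∀ i, S i) → ℝ, Measurable f →
      (∀ x, |f x| ≤ B) → Measure.pi (fun i => P i N)
        {o | ε ≤ |∫ x, f x ∂(Measure.pi (hybrid γ s o)) - ∫ x, f x ∂(Measure.pi γ)|} ≤ δ N := by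
    intro s
    induction s using Finset.induction_on with
    | empty =>
      intro ε hε
      refine ⟨0, by simp, fun N _ f _ _ => le_of_eq ?_⟩
      have : ∀ o : ∀ i, ℝ≥0 × (Fin N → S i), hybrid γ ∅ o = γ := fun o => by
        funext i; simp [hybrid]
      simp [this, hε.not_ge]
    | insert c s hcs ih =>
      intro ε hε
      set D : ℝ := ∏ i, max 1 (max (C i : ℝ) ((γ i).real Set.univ)) with hD
      have hDpos : 0 < D := Finset.prod_pos fun i _ => lt_max_of_lt_left one_pos
      obtain ⟨δ₁, hδ₁, h₁⟩ := ih (ε / 2) (half_pos hε)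
      obtain ⟨δ₂, hδ₂, h₂⟩ := hconv c (B * D) (mul_pos hB hDpos) (ε / 2) (half_pos hε)
      refine ⟨fun N => δ₂ N + δ₁ N, ?_, fun N hN f hf hfB => ?_⟩
      · rw [ENNReal.tsum_add]; exact ENNReal.add_ne_top.2 ⟨hδ₂, hδ₁⟩
      have : ∀ i, IsProbabilityMeasure (P i N) := fun i => hP i N hN
      have step := measure_hybrid_insert_le (γ := γ) hN (fun i => hC i N hN) hcs hB hD.ge
        (h₂ N hN) hf hfB
      refine (measure_mono fun o ho => ?_).trans
        ((measure_union_le _ _).trans (add_le_add step (h₁ N hN f hf hfB)))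
      simp only [Set.mem_ofPred_eq, Set.mem_union] at ho ⊢
      by_contra! hcon
      have := abs_sub_le (∫ x, f x ∂(Measure.pi (hybrid γ (insert c s) o)))
        (∫ x, f x ∂(Measure.pi (hybrid γ s o))) (∫ x, f x ∂(Measure.pi γ))
      linarith [hcon.1, hcon.2]
  obtain ⟨δ, hδ, h⟩ := key Finset.univ ε hε
  refine ⟨δ, hδ, fun N hN f hf hfB => ?_⟩
  have e : ∀ o : ∀ i, ℝ≥0 × (Fin N → S i),
      hybrid γ Finset.univ o = fun i => particleMeasure (o i).1 (o i).2 := fun o => by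
    funext i; simp [hybrid]
  simpa only [e] using h N hN f hf hfB

end Hybrid

/-! ### Mutation and correction at a node -/

section Maps

variable {T : RootedTree.{u}} {E : T → Type v} [∀ a, MeasurableSpace (E a)]

theorem measurable_concat [Finite T] (a : T) : Measurable (concat (E := E) a) :=
  measurable_pi_lambda _ fun b =>
    (measurable_pi_apply (⟨b.1, childToward_le b⟩ : Set.Ici (childToward b).1)).comp
      (measurable_pi_apply (childToward b))

theorem measurable_glue (a : T) : Measurable (glue (E := E) a) := by
  refine measurable_pi_lambda _ fun b => ?_
  obtain ⟨b, hb⟩ := b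
  by_cases h : a = b
  · subst h
    simpa [glue] using measurable_snd
  · simp only [glue, h, dite_false]
    exact (measurable_pi_apply (⟨b, lt_of_le_of_ne hb h⟩ : Set.Ioi a)).comp measurable_fst

end Maps

theorem measurable_normalize {α S : Type*} [MeasurableSpace α] [MeasurableSpace S]
    {m : α → Measure S} (hm : Measurable m) : Measurable fun x => normalize (m x) := by
  refine Measure.measurable_of_measurable_coe _ fun s hs => ?_
  simp only [normalize, Measure.smul_apply, smul_eq_mul]
  exact ((Measure.measurable_coe .univ).comp hm).inv.mul ((Measure.measurable_coe hs).comp hm)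

theorem normalize_univ_le_one {S : Type*} [MeasurableSpace S] (μ : Measure S) :
    normalize μ Set.univ ≤ 1 := by
  simp only [normalize, Measure.smul_apply, smul_eq_mul]
  exact ENNReal.inv_mul_le_one _

instance isFiniteMeasure_normalize {S : Type*} [MeasurableSpace S] (μ : Measure S) :
    IsFiniteMeasure (normalize μ) :=
  ⟨(normalize_univ_le_one μ).trans_lt ENNReal.one_lt_top⟩

theorem isProbabilityMeasure_normalize {S : Type*} [MeasurableSpace S] (μ : Measure S)
    [IsFiniteMeasure μ] (h : μ ≠ 0) : IsProbabilityMeasure (normalize μ) :=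
  ⟨by simpa [normalize] using
    ENNReal.inv_mul_cancel (Measure.measure_univ_ne_zero.2 h) (measure_ne_top μ _)⟩

theorem map_bind {α β γ : Type*} [MeasurableSpace α] [MeasurableSpace β] [MeasurableSpace γ]
    {m : Measure α} {f : α → Measure β} (hf : Measurable f) {g : β → γ} (hg : Measurable g) :
    (m.bind f).map g = m.bind fun x => (f x).map g := by
  ext s hs
  have h : Measurable fun x => (f x).map g := (Measure.measurable_map g hg).comp hf
  rw [Measure.map_apply hg hs, Measure.bind_apply (hg hs) hf.aemeasurable,
    Measure.bind_apply hs h.aemeasurable]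
  simp only [Measure.map_apply hg hs]

namespace Model

variable {T : RootedTree.{u}} {E : T → Type v} [∀ a, MeasurableSpace (E a)] (M : Model T E)

instance isMarkovKernel_K (a : T) : IsMarkovKernel (M.K a) := M.markov_K a

/-- The law of the point of `FullSpace E a` obtained from `y` by one step of the proposal kernel
at `a`. -/
noncomputable def extend (a : T) (y : ChildrenSpace E a) : Measure (FullSpace E a) :=
  (M.K a y).map fun t => glue a (y, t)

theorem measurable_glue_mk (a : T) (y : ChildrenSpace E a) :
    Measurable fun t : E a => glue a (y, t) :=
  (measurable_glue a).comp measurable_prodMk_left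

instance isProbabilityMeasure_extend (a : T) (y : ChildrenSpace E a) :
    IsProbabilityMeasure (M.extend a y) :=
  Measure.isProbabilityMeasure_map (measurable_glue_mk a y).aemeasurable

theorem measurable_extend (a : T) : Measurable (M.extend a) := by
  refine Measure.measurable_of_measurable_coe _ fun s hs => ?_
  have : ∀ y, M.extend a y s = M.K a y (Prod.mk y ⁻¹' (glue a ⁻¹' s)) := fun y =>
    Measure.map_apply (measurable_glue_mk a y) hs
  simp only [this]
  exact Kernel.measurable_kernel_prodMk_left (measurable_glue a hs)

theorem map_glue_compProd (a : T) (m : Measure (ChildrenSpace E a)) [IsFiniteMeasure m] :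
    (m.compProd (M.K a)).map (glue a) = m.bind (M.extend a) := by
  ext s hs
  rw [Measure.map_apply (measurable_glue a) hs, Measure.compProd_apply (measurable_glue a hs),
    Measure.bind_apply hs (M.measurable_extend a).aemeasurable]
  refine lintegral_congr fun y => ?_
  exact (Measure.map_apply (measurable_glue_mk a y) hs).symm

theorem measurable_integral_extend (a : T) {φ : FullSpace E a → ℝ} (hφ : Measurable φ) {B : ℝ}
    (hB : ∀ x, |φ x| ≤ B) : Measurable fun y => ∫ x, φ x ∂(M.extend a y) :=
  measurable_integral_of_abs_le (M.measurable_extend a) hφ hB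

theorem abs_integral_extend_le (a : T) {φ : FullSpace E a → ℝ} {B : ℝ}
    (hB : ∀ x, |φ x| ≤ B) (y : ChildrenSpace E a) : |∫ x, φ x ∂(M.extend a y)| ≤ B := by
  simpa using norm_integral_le_of_norm_le_const (μ := M.extend a y) (f := φ) (ae_of_all _ hB)

theorem extM_of_not_isMax {M : Model T E} {a : T} (ha : ¬ IsMax a) :
    M.extM a = (M.auxM a).bind (M.extend a) := by
  have := M.finite_auxM a ha
  rw [extM, dif_neg ha, map_glue_compProd]

theorem integral_bind_extend (a : T) (m : Measure (ChildrenSpace E a)) [IsFiniteMeasure m]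
    {φ : FullSpace E a → ℝ} (hφ : Measurable φ) {B : ℝ} (hB : ∀ x, |φ x| ≤ B) :
    ∫ x, φ x ∂(m.bind (M.extend a)) = ∫ y, ∫ x, φ x ∂(M.extend a y) ∂m := by
  rw [← map_glue_compProd, integral_map (measurable_glue a).aemeasurable hφ.aestronglyMeasurable,
    Measure.integral_compProd
      (f := fun p => φ (glue a p))
      (integrable_of_abs_le (hφ.comp (measurable_glue a)) fun p => hB _)]
  refine integral_congr_ae (ae_of_all _ fun y => ?_)
  exact (integral_map (measurable_glue_mk a y).aemeasurable hφ.aestronglyMeasurable).symm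

theorem mutate_eq {N : ℕ} (a : T) (y : Fin N → ChildrenSpace E a) :
    M.mutate a y = Measure.pi fun n => M.extend a (y n) := rfl

instance isProbabilityMeasure_mutate {N : ℕ} (a : T) (y : Fin N → ChildrenSpace E a) :
    IsProbabilityMeasure (M.mutate a y) := by
  rw [mutate_eq]; infer_instance

theorem measurable_mutate {N : ℕ} (a : T) : Measurable (M.mutate (N := N) a) :=
  measurable_measure_pi fun n => (M.measurable_extend a).comp (measurable_pi_apply n)

variable [Finite T]

/-- The reweighting by the auxiliary weight function of `a` of a measure on the product of the
spaces of the children of `a`. -/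
noncomputable def reweight (a : T) (m : Measure (∀ c : Child a, FullSpace E c.1)) :
    Measure (ChildrenSpace E a) :=
  (m.map (concat a)).withDensity fun x => (M.wAux a x : ℝ≥0∞)

theorem auxMN_eq_reweight {N : ℕ} (a : T)
    (out : ∀ c : Child a, ℝ≥0 × (Fin N → FullSpace E c.1)) :
    M.auxMN a out =
      M.reweight a (Measure.pi fun c => particleMeasure (out c).1 (out c).2) := rfl

theorem auxM_eq_reweight {M : Model T E} (h₁ : M.AbsContPositive) {a : T} (ha : ¬ IsMax a) :
    M.auxM a = M.reweight a (Measure.pi fun c : Child a => M.extM c.1) :=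
  (h₁.derivAux a ha).2

section Reweight

variable {M} {a : T} (hw : Measurable (M.wAux a))

include hw

theorem reweight_apply (m : Measure (∀ c : Child a, FullSpace E c.1)) {s : Set (ChildrenSpace E a)}
    (hs : MeasurableSet s) : M.reweight a m s =
      ∫⁻ x, s.indicator (fun y => (M.wAux a y : ℝ≥0∞)) (concat a x) ∂m := by
  rw [reweight, withDensity_apply _ hs, ← lintegral_indicator hs,
    lintegral_map (hw.coe_nnreal_ennreal.indicator hs) (measurable_concat a)]

theorem measurable_reweight : Measurable (M.reweight a) := by
  refine Measure.measurable_of_measurable_coe _ fun s hs => ?_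
  simp only [reweight_apply hw _ hs]
  exact Measure.measurable_lintegral
    ((hw.coe_nnreal_ennreal.indicator hs).comp (measurable_concat a))

theorem reweight_univ (m : Measure (∀ c : Child a, FullSpace E c.1)) :
    M.reweight a m Set.univ = ∫⁻ x, (M.wAux a (concat a x) : ℝ≥0∞) ∂m := by
  rw [reweight_apply hw m .univ]; simp

theorem reweight_univ_le {C : ℝ≥0} (hC : ∀ x, M.wAux a x ≤ C)
    (m : Measure (∀ c : Child a, FullSpace E c.1)) :
    M.reweight a m Set.univ ≤ C * m Set.univ := by
  rw [reweight_univ hw]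
  exact (lintegral_mono fun x => ENNReal.coe_le_coe.2 (hC _)).trans (by simp)

theorem reweight_ne_zero (hpos : ∀ x, 0 < M.wAux a x)
    {m : Measure (∀ c : Child a, FullSpace E c.1)} (hm : m ≠ 0) : M.reweight a m ≠ 0 := by
  rw [← Measure.measure_univ_ne_zero, reweight_univ hw]
  intro h
  have hmeas : Measurable fun x => (M.wAux a (concat a x) : ℝ≥0∞) :=
    (hw.comp (measurable_concat a)).coe_nnreal_ennreal
  rw [lintegral_eq_zero_iff hmeas] at h
  have : ∀ᵐ _x ∂m, False := by
    filter_upwards [h] with x hx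
    simp [(hpos _).ne'] at hx
  exact hm (ae_eq_bot.1 (eventually_false_iff_eq_bot.1 this))

theorem integral_reweight (m : Measure (∀ c : Child a, FullSpace E c.1))
    {g : ChildrenSpace E a → ℝ} (hg : Measurable g) :
    ∫ y, g y ∂(M.reweight a m) = ∫ x, M.wAux a (concat a x) * g (concat a x) ∂m := by
  have hmeas : Measurable fun y => M.wAux a y • g y := hw.smul hg
  rw [reweight, integral_withDensity_eq_integral_smul hw,
    integral_map (measurable_concat a).aemeasurable hmeas.aestronglyMeasurable]
  rfl

end Reweight

/-! ### The law of the output at an inner node -/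

/-- The conditional law of the output at an inner node, given the outputs at its children. -/
noncomputable def stepLaw {N : ℕ} (a : T)
    (out : ∀ c : Child a, ℝ≥0 × (Fin N → FullSpace E c.1)) :
    Measure (ℝ≥0 × (Fin N → FullSpace E a)) :=
  (Measure.pi fun _ : Fin N => normalize (M.auxMN a out)).bind fun y =>
    (M.mutate a y).map fun x => ((M.auxMN a out Set.univ).toNNReal, x)

theorem dacSMC_of_isMax (N : ℕ) {a : T} (h : IsMax a) :
    M.dacSMC N a = (Measure.pi fun _ : Fin N => M.leafProposal h).map fun x => (1, x) := by
  rw [dacSMC, dif_pos h]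

theorem dacSMC_of_not_isMax (N : ℕ) {a : T} (h : ¬ IsMax a) :
    M.dacSMC N a = (Measure.pi fun c : Child a => M.dacSMC N c.1).bind (M.stepLaw a) := by
  rw [dacSMC, dif_neg h]; rfl

theorem stepLaw_eq_map {N : ℕ} (a : T) (out : ∀ c : Child a, ℝ≥0 × (Fin N → FullSpace E c.1)) :
    M.stepLaw a out =
      ((Measure.pi fun _ : Fin N => normalize (M.auxMN a out)).bind (M.mutate a)).map
        (Prod.mk (M.auxMN a out Set.univ).toNNReal) :=
  (map_bind (M.measurable_mutate a) measurable_prodMk_left).symm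

/-- For a non-zero correction the particles returned at an inner node are, conditionally on the
outputs at its children, independent and identically distributed. -/
theorem stepLaw_eq_map_pi {N : ℕ} (a : T)
    (out : ∀ c : Child a, ℝ≥0 × (Fin N → FullSpace E c.1)) [IsFiniteMeasure (M.auxMN a out)]
    (h : M.auxMN a out ≠ 0) :
    M.stepLaw a out =
      (Measure.pi fun _ : Fin N => (normalize (M.auxMN a out)).bind (M.extend a)).map
        (Prod.mk (M.auxMN a out Set.univ).toNNReal) := by
  have := isProbabilityMeasure_normalize _ h
  rw [stepLaw_eq_map, ← pi_bind_pi fun _ => M.measurable_extend a]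
  rfl

theorem measurable_auxMN {a : T} (hw : Measurable (M.wAux a)) (N : ℕ) :
    Measurable (M.auxMN (N := N) a) :=
  (measurable_reweight hw).comp (measurable_measure_pi fun c =>
    measurable_particleMeasure.comp (measurable_pi_apply c))

theorem measurable_stepLaw {a : T} (hw : Measurable (M.wAux a)) (N : ℕ) :
    Measurable (M.stepLaw (N := N) a) := by
  have hA := M.measurable_auxMN hw N
  have hpi : Measurable fun out : ∀ c : Child a, ℝ≥0 × (Fin N → FullSpace E c.1) =>
      Measure.pi fun _ : Fin N => normalize (M.auxMN a out) :=
    measurable_measure_pi fun _ => measurable_normalize hA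
  let ν : Kernel (∀ c : Child a, ℝ≥0 × (Fin N → FullSpace E c.1)) (Fin N → FullSpace E a) :=
    ⟨fun out => (Measure.pi fun _ : Fin N => normalize (M.auxMN a out)).bind (M.mutate a),
      (Measure.measurable_bind' (M.measurable_mutate a)).comp hpi⟩
  have hν : IsFiniteKernel ν := by
    refine ⟨1, ENNReal.one_lt_top, fun out => ?_⟩
    change ((Measure.pi fun _ : Fin N => normalize (M.auxMN a out)).bind (M.mutate a)) _ ≤ 1
    rw [Measure.bind_apply .univ (M.measurable_mutate a).aemeasurable]
    simp only [measure_univ, lintegral_const, one_mul, Measure.pi_univ]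
    exact Finset.prod_le_one (fun _ _ => zero_le) fun _ _ => normalize_univ_le_one _
  refine Measure.measurable_of_measurable_coe _ fun s hs => ?_
  have hz : Measurable fun out : ∀ c : Child a, ℝ≥0 × (Fin N → FullSpace E c.1) =>
      (M.auxMN a out Set.univ).toNNReal :=
    ((Measure.measurable_coe .univ).comp hA).ennreal_toNNReal
  have hz' : Measurable fun p : (∀ c : Child a, ℝ≥0 × (Fin N → FullSpace E c.1)) ×
      (Fin N → FullSpace E a) => ((M.auxMN a p.1 Set.univ).toNNReal, p.2) :=
    (hz.comp measurable_fst).prodMk measurable_snd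
  have : ∀ out, M.stepLaw a out s = ν out (Prod.mk out ⁻¹'
      ((fun p : (∀ c : Child a, ℝ≥0 × (Fin N → FullSpace E c.1)) ×
        (Fin N → FullSpace E a) => ((M.auxMN a p.1 Set.univ).toNNReal, p.2)) ⁻¹' s)) := by
    intro out
    rw [stepLaw_eq_map, Measure.map_apply measurable_prodMk_left hs]
    rfl
  simp only [this]
  exact Kernel.measurable_kernel_prodMk_left (hz' hs)

/-! ### Induction over the tree -/

theorem measurableSet_mass {S : Type*} [MeasurableSpace S] {N : ℕ} (C : ℝ≥0) :
    MeasurableSet {o : ℝ≥0 × (Fin N → S) | 0 < o.1 ∧ o.1 ≤ C} :=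
  measurable_fst (measurableSet_Ioc (a := 0) (b := C))

/-- The properties of the algorithm at the node `a` that propagate from the children to the
parent. The bound of the masses does not depend on the number of particles. Positivity of the masses
rules out that a correction step at the parent normalizes the zero measure. -/
structure Consistent (a : T) : Prop where
  finite : IsFiniteMeasure (M.extM a)
  ne_zero : M.extM a ≠ 0
  prob : ∀ N, 0 < N → IsProbabilityMeasure (M.dacSMC N a)
  mass : ∃ C : ℝ≥0, ∀ N, 0 < N → ∀ᵐ o ∂(M.dacSMC N a), 0 < o.1 ∧ o.1 ≤ C
  conv : UniformCompleteConv (fun N => M.dacSMC N a) (M.extM a)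

theorem consistent_of_isMax {a : T} (h : IsMax a) : M.Consistent a := by
  have hext : M.extM a = M.leafProposal h := by rw [extM, dif_pos h]
  have hprob : IsProbabilityMeasure (M.leafProposal h) :=
    M.isProbabilityMeasure_extend a (leafPoint h)
  refine ⟨hext ▸ inferInstance, hext ▸ IsProbabilityMeasure.ne_zero _, fun N _ => ?_,
    ⟨1, fun N _ => ?_⟩, fun B hB ε hε => ?_⟩
  · rw [M.dacSMC_of_isMax N h]
    exact Measure.isProbabilityMeasure_map measurable_prodMk_left.aemeasurable
  · rw [M.dacSMC_of_isMax N h, ae_map_iff measurable_prodMk_left.aemeasurable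
      (measurableSet_mass 1)]
    simp
  · refine ⟨fun N => _, tsum_exp_bound_ne_top (c := ε ^ 2 / (2 * B ^ 2)) (by positivity),
      fun N hN φ hφ hφB => ?_⟩
    have hmeas : MeasurableSet {o : ℝ≥0 × (Fin N → FullSpace E a) |
        ε ≤ |∫ x, φ x ∂(particleMeasure o.1 o.2) - ∫ x, φ x ∂(M.extM a)|} :=
      measurableSet_le measurable_const
        ((measurable_integral_of_abs_le measurable_particleMeasure hφ hφB).sub_const _).norm
    beta_reduce
    rw [M.dacSMC_of_isMax N h, Measure.map_apply measurable_prodMk_left hmeas]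
    refine le_trans (le_of_eq ?_) (hoeffding_pi (M.leafProposal h) hN hφ hB hφB hε)
    congr 1
    ext x
    simp [integral_particleMeasure _ _ hφ, hext]

variable {M}

theorem measurable_wAux (h₁ : M.AbsContPositive) {a : T} (ha : ¬ IsMax a) :
    Measurable (M.wAux a) := (h₁.derivAux a ha).1

theorem integral_extM (h₁ : M.AbsContPositive) {a : T} (ha : ¬ IsMax a)
    {φ : FullSpace E a → ℝ} (hφ : Measurable φ) {B : ℝ} (hB : ∀ x, |φ x| ≤ B) :
    ∫ x, φ x ∂(M.extM a) = ∫ x, M.wAux a (concat a x) *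
      ∫ y, φ y ∂(M.extend a (concat a x)) ∂(Measure.pi fun c : Child a => M.extM c.1) := by
  have := M.finite_auxM a ha
  rw [extM_of_not_isMax ha, integral_bind_extend _ _ _ hφ hB, auxM_eq_reweight h₁ ha,
    integral_reweight (measurable_wAux h₁ ha) _ (M.measurable_integral_extend a hφ hB)]

theorem extM_ne_zero (h₁ : M.AbsContPositive) {a : T} (ha : ¬ IsMax a)
    (hc : ∀ c : Child a, M.Consistent c.1) : M.extM a ≠ 0 := by
  have : ∀ c : Child a, IsFiniteMeasure (M.extM c.1) := fun c => (hc c).finite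
  have hpi : (Measure.pi fun c : Child a => M.extM c.1) ≠ 0 := by
    rw [← Measure.measure_univ_ne_zero, Measure.pi_univ]
    exact Finset.prod_ne_zero_iff.2 fun c _ => Measure.measure_univ_ne_zero.2 (hc c).ne_zero
  rw [extM_of_not_isMax ha, ← Measure.measure_univ_ne_zero,
    Measure.bind_apply .univ (M.measurable_extend a).aemeasurable]
  simpa [auxM_eq_reweight h₁ ha] using
    reweight_ne_zero (measurable_wAux h₁ ha) (h₁.posAux a ha) hpi

theorem isFiniteMeasure_auxMN {a : T} {N : ℕ} {W : ℝ≥0} (hw : Measurable (M.wAux a)) (hW : ∀ x, M.wAux a x ≤ W)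
    (out : ∀ c : Child a, ℝ≥0 × (Fin N → FullSpace E c.1)) :
    IsFiniteMeasure (M.auxMN a out) :=
  ⟨(reweight_univ_le hw hW _).trans_lt
    (ENNReal.mul_lt_top ENNReal.coe_lt_top (measure_lt_top _ _))⟩

section Step

variable {a : T} {N : ℕ} (hw : Measurable (M.wAux a)) (hpos : ∀ x, 0 < M.wAux a x)
  {W : ℝ≥0} (hW : ∀ x, M.wAux a x ≤ W) (hN : 0 < N)
  {C : Child a → ℝ≥0} {out : ∀ c : Child a, ℝ≥0 × (Fin N → FullSpace E c.1)}
  (hout : ∀ c, 0 < (out c).1 ∧ (out c).1 ≤ C c)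

include hw hpos hN hout in
theorem auxMN_ne_zero : M.auxMN a out ≠ 0 := by
  refine reweight_ne_zero hw hpos ?_
  rw [← Measure.measure_univ_ne_zero, Measure.pi_univ]
  refine Finset.prod_ne_zero_iff.2 fun c _ => ?_
  rw [particleMeasure_univ hN]
  exact_mod_cast (hout c).1.ne'

include hw hW hN hout in
theorem auxMN_mass_le : (M.auxMN a out Set.univ).toNNReal ≤ W * ∏ c, C c := by
  suffices h : M.auxMN a out Set.univ ≤ (W * ∏ c, C c : ℝ≥0) by
    simpa only [ENNReal.toNNReal_coe] using ENNReal.toNNReal_mono ENNReal.coe_ne_top h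
  refine (reweight_univ_le hw hW _).trans ?_
  rw [Measure.pi_univ, ENNReal.coe_mul, ENNReal.ofNNReal_finsetProd]
  gcongr with c
  rw [particleMeasure_univ hN]
  exact_mod_cast (hout c).2

include hw hpos hW hN hout in
theorem isProbabilityMeasure_stepLaw : IsProbabilityMeasure (M.stepLaw a out) := by
  have := isFiniteMeasure_auxMN hw hW out
  have h := auxMN_ne_zero hw hpos hN hout
  have := isProbabilityMeasure_normalize _ h
  have : IsProbabilityMeasure ((normalize (M.auxMN a out)).bind (M.extend a)) :=
    isProbabilityMeasure_bind (M.measurable_extend a).aemeasurable (ae_of_all _ inferInstance)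
  rw [M.stepLaw_eq_map_pi a out h]
  exact Measure.isProbabilityMeasure_map measurable_prodMk_left.aemeasurable

include hw hpos hW hN hout in
theorem stepLaw_mass_compl :
    M.stepLaw a out {o | 0 < o.1 ∧ o.1 ≤ W * ∏ c, C c}ᶜ = 0 := by
  have hfin := isFiniteMeasure_auxMN hw hW out
  have h := auxMN_ne_zero hw hpos hN hout
  have hz : 0 < (M.auxMN a out Set.univ).toNNReal ∧
      (M.auxMN a out Set.univ).toNNReal ≤ W * ∏ c, C c :=
    ⟨ENNReal.toNNReal_pos (Measure.measure_univ_ne_zero.2 h) (measure_ne_top _ _),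
      auxMN_mass_le hw hW hN hout⟩
  rw [M.stepLaw_eq_map_pi a out h,
    Measure.map_apply measurable_prodMk_left (measurableSet_mass _).compl]
  simp [hz]

include hw in
/-- The mass of the corrected measure cancels its normalization. -/
theorem mass_mul_integral_normalize [IsFiniteMeasure (M.auxMN a out)] (h : M.auxMN a out ≠ 0)
    {φ : FullSpace E a → ℝ} (hφ : Measurable φ) {B : ℝ} (hB : ∀ x, |φ x| ≤ B) :
    (M.auxMN a out Set.univ).toNNReal *
      ∫ x, φ x ∂((normalize (M.auxMN a out)).bind (M.extend a)) =
    ∫ x, M.wAux a (concat a x) * ∫ y, φ y ∂(M.extend a (concat a x))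
      ∂(Measure.pi fun c => particleMeasure (out c).1 (out c).2) := by
  rw [M.integral_bind_extend a _ hφ hB, normalize, integral_smul_measure, smul_eq_mul,
    ← mul_assoc, ENNReal.toReal_inv]
  have h0 : (M.auxMN a out Set.univ).toReal ≠ 0 :=
    ENNReal.toReal_ne_zero.2 ⟨Measure.measure_univ_ne_zero.2 h, measure_ne_top _ _⟩
  rw [ENNReal.coe_toNNReal_eq_toReal, mul_inv_cancel₀ h0, one_mul, auxMN_eq_reweight,
    integral_reweight hw _ (M.measurable_integral_extend a hφ hB)]

include hw hpos hW hN hout in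
/-- If the corrected product of the particle measures at the children is `ε / 2`-close to its limit
`l`, then a deviation by `ε` is due to the sampling of the particles at the node itself. -/
theorem stepLaw_deviation_le {φ : FullSpace E a → ℝ} (hφ : Measurable φ) {B : ℝ} (hBpos : 0 < B)
    (hB : ∀ x, |φ x| ≤ B) {ε : ℝ} (hε : 0 < ε) {D : ℝ} (hDpos : 0 < D)
    (hD : (W * ∏ c, C c : ℝ≥0) ≤ D) {l : ℝ}
    (hl : |∫ x, M.wAux a (concat a x) * ∫ y, φ y ∂(M.extend a (concat a x))
      ∂(Measure.pi fun c => particleMeasure (out c).1 (out c).2) - l| < ε / 2) :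
    M.stepLaw a out {o | ε ≤ |∫ x, φ x ∂(particleMeasure o.1 o.2) - l|} ≤
      ENNReal.ofReal (2 * Real.exp (-(N * ((ε / (2 * D)) ^ 2 / (2 * B ^ 2))))) := by
  have hfin := isFiniteMeasure_auxMN hw hW out
  have h := auxMN_ne_zero hw hpos hN hout
  have := isProbabilityMeasure_normalize _ h
  have : IsProbabilityMeasure ((normalize (M.auxMN a out)).bind (M.extend a)) :=
    isProbabilityMeasure_bind (M.measurable_extend a).aemeasurable (ae_of_all _ inferInstance)
  have hmeas : MeasurableSet {o : ℝ≥0 × (Fin N → FullSpace E a) |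
      ε ≤ |∫ x, φ x ∂(particleMeasure o.1 o.2) - l|} :=
    measurableSet_le measurable_const
      ((measurable_integral_of_abs_le measurable_particleMeasure hφ hB).sub_const _).norm
  rw [M.stepLaw_eq_map_pi a out h, Measure.map_apply measurable_prodMk_left hmeas]
  refine (measure_mono fun x hx => ?_).trans (hoeffding_pi _ hN hφ hBpos hB (ε := ε / (2 * D))
    (by positivity))
  simp only [Set.mem_preimage, Set.mem_ofPred_eq, integral_particleMeasure _ _ hφ] at hx ⊢
  rw [← mass_mul_integral_normalize hw h hφ hB] at hl
  set z : ℝ≥0 := (M.auxMN a out Set.univ).toNNReal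
  have hz : (z : ℝ) ≤ D := le_trans
    (by exact_mod_cast auxMN_mass_le hw hW hN hout) hD
  set p : ℝ := (N : ℝ)⁻¹ * ∑ n, φ (x n)
  set q : ℝ := ∫ x, φ x ∂((normalize (M.auxMN a out)).bind (M.extend a))
  have h1 : ε / 2 ≤ z * |p - q| := by
    have e : z * |p - q| = |z * p - z * q| := by
      rw [← mul_sub, abs_mul, abs_of_nonneg z.coe_nonneg]
    rw [e]
    have := abs_sub_le (z * p) (z * q) l
    linarith
  rw [div_le_iff₀ (by positivity)]
  nlinarith [mul_le_mul_of_nonneg_right hz (abs_nonneg (p - q))]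

end Step

theorem consistent_of_not_isMax (h₁ : M.AbsContPositive) (h₂ : M.BoundedWeights) {a : T}
    (ha : ¬ IsMax a) (hc : ∀ c : Child a, M.Consistent c.1) : M.Consistent a := by
  classical
  have hw := measurable_wAux h₁ ha
  have hpos := h₁.posAux a ha
  obtain ⟨W, hW⟩ := h₂.bddAux a ha
  have hfin : ∀ c : Child a, IsFiniteMeasure (M.extM c.1) := fun c => (hc c).finite
  have hne : ∀ c : Child a, Nonempty (FullSpace E c.1) := fun c => by
    by_contra hempty
    rw [not_nonempty_iff] at hempty
    exact (hc c).ne_zero (Measure.eq_zero_of_isEmpty _)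
  choose C hC using fun c => (hc c).mass
  have hall : ∀ N, 0 < N → ∀ᵐ o ∂(Measure.pi fun c : Child a => M.dacSMC N c.1),
      ∀ c, 0 < (o c).1 ∧ (o c).1 ≤ C c := fun N hN => by
    have : ∀ c : Child a, IsProbabilityMeasure (M.dacSMC N c.1) := fun c => (hc c).prob N hN
    exact eventually_all.2 fun c => (Measure.quasiMeasurePreserving_eval
      (fun c : Child a => M.dacSMC N c.1) c).ae (hC c N hN)
  refine ⟨?_, extM_ne_zero h₁ ha hc, fun N hN => ?_, ⟨W * ∏ c, C c, fun N hN => ?_⟩, ?_⟩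
  · have := M.finite_auxM a ha
    rw [extM, dif_neg ha]
    infer_instance
  · have : ∀ c : Child a, IsProbabilityMeasure (M.dacSMC N c.1) := fun c => (hc c).prob N hN
    rw [M.dacSMC_of_not_isMax N ha]
    refine isProbabilityMeasure_bind (M.measurable_stepLaw hw N).aemeasurable ?_
    filter_upwards [hall N hN] with o ho
    exact isProbabilityMeasure_stepLaw hw hpos hW hN ho
  · rw [ae_iff, M.dacSMC_of_not_isMax N ha]
    change (Measure.bind _ _) {o : ℝ≥0 × (Fin N → FullSpace E a) | 0 < o.1 ∧ o.1 ≤ W * ∏ c, C c}ᶜ = 0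
    rw [Measure.bind_apply (measurableSet_mass _).compl (M.measurable_stepLaw hw N).aemeasurable]
    refine lintegral_eq_zero_of_ae_eq_zero ?_
    filter_upwards [hall N hN] with o ho
    exact stepLaw_mass_compl hw hpos hW hN ho
  · -- The bound is the sum of those for the product over the children and for the sampling at `a`.
    intro B hB ε hε
    -- Adding one makes the bounds positive without a discussion of `W` and `C`.
    set D : ℝ := (W * ∏ c, C c : ℝ≥0) + 1 with hD
    have hDpos : 0 < D := by positivity
    obtain ⟨δ, hδ, h⟩ := measure_pi_particleMeasure_le (γ := fun c : Child a => M.extM c.1)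
      (P := fun c N => M.dacSMC N c.1) (fun c N hN => (hc c).prob N hN) (C := C)
      (fun c N hN => (hC c N hN).mono fun _ ho => ho.2) (fun c => (hc c).conv)
      (B := (W + 1) * B) (by positivity) (ε := ε / 2) (half_pos hε)
    refine ⟨fun N => δ N + ENNReal.ofReal
      (2 * Real.exp (-(N * ((ε / (2 * D)) ^ 2 / (2 * B ^ 2))))), ?_, fun N hN φ hφ hφB => ?_⟩
    · rw [ENNReal.tsum_add]
      exact ENNReal.add_ne_top.2 ⟨hδ, tsum_exp_bound_ne_top (by positivity)⟩
    have : ∀ c : Child a, IsProbabilityMeasure (M.dacSMC N c.1) := fun c => (hc c).prob N hN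
    set f : (∀ c : Child a, FullSpace E c.1) → ℝ := fun x => M.wAux a (concat a x) *
      ∫ y, φ y ∂(M.extend a (concat a x)) with hf
    have hfm : Measurable f := ((hw.comp (measurable_concat a)).coe_nnreal_real).mul
      ((M.measurable_integral_extend a hφ hφB).comp (measurable_concat a))
    have hfB : ∀ x, |f x| ≤ (W + 1) * B := fun x => by
      rw [hf, abs_mul, abs_of_nonneg (NNReal.coe_nonneg _)]
      refine mul_le_mul ?_ (M.abs_integral_extend_le a hφB _) (abs_nonneg _) (by positivity)
      exact (NNReal.coe_le_coe.2 (hW _)).trans (by linarith)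
    have key := h N hN f hfm hfB
    set A : Set (∀ c : Child a, ℝ≥0 × (Fin N → FullSpace E c.1)) :=
      {o | ε / 2 ≤ |∫ x, f x ∂(Measure.pi fun i => particleMeasure (o i).1 (o i).2) -
        ∫ x, f x ∂(Measure.pi fun c : Child a => M.extM c.1)|} with hA
    have hAm : MeasurableSet A :=
      measurableSet_le measurable_const ((measurable_integral_of_abs_le
        (m := fun o : ∀ c : Child a, ℝ≥0 × (Fin N → FullSpace E c.1) =>
          Measure.pi fun i => particleMeasure (o i).1 (o i).2)
        (measurable_measure_pi fun c => measurable_particleMeasure.comp (measurable_pi_apply c))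
        hfm hfB).sub_const _).norm
    have hmeas : MeasurableSet {o : ℝ≥0 × (Fin N → FullSpace E a) |
        ε ≤ |∫ x, φ x ∂(particleMeasure o.1 o.2) - ∫ x, φ x ∂(M.extM a)|} :=
      measurableSet_le measurable_const
        ((measurable_integral_of_abs_le measurable_particleMeasure hφ hφB).sub_const _).norm
    beta_reduce
    rw [M.dacSMC_of_not_isMax N ha,
      Measure.bind_apply hmeas (M.measurable_stepLaw hw N).aemeasurable]
    refine (lintegral_mono_ae (g := fun o => A.indicator 1 o + ENNReal.ofReal
      (2 * Real.exp (-(N * ((ε / (2 * D)) ^ 2 / (2 * B ^ 2)))))) ?_).trans ?_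
    · filter_upwards [hall N hN] with o ho
      by_cases hoA : o ∈ A
      · have := isProbabilityMeasure_stepLaw hw hpos hW hN ho
        rw [Set.indicator_of_mem hoA]
        exact prob_le_one.trans le_self_add
      · refine le_trans ?_ le_add_self
        rw [integral_extM h₁ ha hφ hφB]
        exact stepLaw_deviation_le hw hpos hW hN ho hφ hB hφB hε hDpos (by linarith)
          (not_le.1 hoA)
    · rw [lintegral_add_right _ measurable_const, lintegral_indicator_one hAm]
      simpa using add_le_add_left key _

theorem consistent (h₁ : M.AbsContPositive) (h₂ : M.BoundedWeights) (a : T) : M.Consistent a := by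
  have : WellFoundedGT T := Finite.to_wellFoundedGT
  induction a using WellFoundedGT.induction with
  | ind a ih =>
    by_cases ha : IsMax a
    · exact M.consistent_of_isMax ha
    · exact consistent_of_not_isMax h₁ h₂ ha fun c => ih c.1 c.2.lt

end Model

/-! ### From complete convergence to almost sure convergence -/

theorem UniformCompleteConv.ae_tendsto {S : Type*} [MeasurableSpace S]
    {Q : ∀ N : ℕ, Measure (ℝ≥0 × (Fin N → S))} {γ : Measure S} (h : UniformCompleteConv Q γ)
    {Ω : Type*} [MeasurableSpace Ω] {P : Measure Ω} {out : ∀ N : ℕ, Ω → ℝ≥0 × (Fin N → S)}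
    (hout : ∀ N, 0 < N → HasLaw (out N) (Q N) P)
    {φ : S → ℝ} (hφ : Measurable φ) {B : ℝ} (hB : ∀ x, |φ x| ≤ B) :
    ∀ᵐ ω ∂P, Tendsto
      (fun N => ∫ x, φ x ∂(particleMeasure (out N ω).1 (out N ω).2)) atTop (𝓝 (∫ x, φ x ∂γ)) := by
  have hB' : ∀ x, |φ x| ≤ |B| + 1 := fun x => (hB x).trans (by linarith [le_abs_self B])
  have key : ∀ k : ℕ, ∀ᵐ ω ∂P, ∀ᶠ N in atTop,
      |∫ x, φ x ∂(particleMeasure (out N ω).1 (out N ω).2) - ∫ x, φ x ∂γ| < 1 / ((k : ℝ) + 1) := by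
    intro k
    obtain ⟨δ, hδ, hbound⟩ := h (|B| + 1) (by positivity) (1 / ((k : ℝ) + 1)) (by positivity)
    -- Nothing is known about the output with zero particles.
    let s : ℕ → Set Ω := fun N => if N = 0 then ∅ else
      {ω | 1 / ((k : ℝ) + 1) ≤
        |∫ x, φ x ∂(particleMeasure (out N ω).1 (out N ω).2) - ∫ x, φ x ∂γ|}
    have hs : ∀ N, P (s N) ≤ δ N := by
      intro N
      rcases Nat.eq_zero_or_pos N with rfl | hN
      · simp [s]
      · have hmeas : MeasurableSet {o : ℝ≥0 × (Fin N → S) | 1 / ((k : ℝ) + 1) ≤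
            |∫ x, φ x ∂(particleMeasure o.1 o.2) - ∫ x, φ x ∂γ|} :=
          measurableSet_le measurable_const
            ((measurable_integral_of_abs_le measurable_particleMeasure hφ hB).sub_const _).norm
        have := hbound N hN φ hφ hB'
        rw [← (hout N hN).measure_eq hmeas] at this
        simpa only [s, hN.ne', if_false] using this
    filter_upwards [ae_eventually_notMem
      (ne_top_of_le_ne_top hδ (ENNReal.tsum_le_tsum hs))] with ω hω
    filter_upwards [hω, eventually_gt_atTop 0] with N hN hN0
    simpa only [s, hN0.ne', if_false, Set.mem_ofPred_eq, not_le] using hN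
  filter_upwards [ae_all_iff.2 key] with ω hω
  rw [Metric.tendsto_atTop']
  intro ε hε
  obtain ⟨k, hk⟩ := exists_nat_one_div_lt hε
  obtain ⟨N₀, hN₀⟩ := eventually_atTop.1 (hω k)
  exact ⟨N₀, fun N hN => (hN₀ N hN.le).trans hk⟩

theorem integral_normalize {S : Type*} [MeasurableSpace S] (μ : Measure S) (φ : S → ℝ) :
    ∫ x, φ x ∂(normalize μ) = (μ Set.univ).toReal⁻¹ * ∫ x, φ x ∂μ := by
  rw [normalize, integral_smul_measure, ENNReal.toReal_inv, smul_eq_mul]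

end DaCSMC

theorem mainTheorem3 {T : RootedTree} [Finite T] {E : T → Type*} [∀ a, MeasurableSpace (E a)]
    (M : DaCSMC.Model T E) (h₁ : M.AbsContPositive) (h₂ : M.BoundedWeights)
    {Ω : Type*} [MeasurableSpace Ω] (P : Measure Ω) [IsProbabilityMeasure P] (a : T)
    (out : ∀ N : ℕ, Ω → ℝ≥0 × (Fin N → DaCSMC.FullSpace E a))
    (hout : ∀ N, 0 < N → HasLaw (out N) (M.dacSMC N a) P)
    (φ : DaCSMC.FullSpace E a → ℝ) (hφ : Measurable φ) (hφb : ∃ C, ∀ x, |φ x| ≤ C) :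
    (∀ᵐ ω ∂P, Tendsto (fun N => ∫ x, φ x ∂(M.ρN a (out N ω))) atTop (𝓝 (∫ x, φ x ∂(M.ρ a)))) ∧
    (∀ᵐ ω ∂P, Tendsto (fun N => ∫ x, φ x ∂(M.μN a (out N ω))) atTop (𝓝 (∫ x, φ x ∂(M.μ a)))) ∧
    (∀ᵐ ω ∂P, Tendsto (fun N => M.ρN a (out N ω) Set.univ) atTop (𝓝 (M.ρ a Set.univ))) := by
  have hcons := DaCSMC.Model.consistent h₁ h₂ a
  obtain ⟨hw, hρ⟩ := h₁.deriv a
  obtain ⟨W, hW⟩ := h₂.bdd a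
  have hρfin := M.finite_ρ a
  have hρNfin : ∀ N ω, IsFiniteMeasure (M.ρN a (out N ω)) := fun N ω =>
    isFiniteMeasure_withDensity (ne_top_of_le_ne_top
      (ENNReal.mul_ne_top (ENNReal.coe_ne_top (r := W)) (measure_ne_top _ Set.univ))
      ((lintegral_mono fun x => ENNReal.coe_le_coe.2 (hW x)).trans_eq (lintegral_const _)))
  -- The first law, for an arbitrary bounded function, so that it applies to `1` as well.
  have law : ∀ ψ : DaCSMC.FullSpace E a → ℝ, Measurable ψ → (∃ C, ∀ x, |ψ x| ≤ C) →
      ∀ᵐ ω ∂P, Tendsto (fun N => ∫ x, ψ x ∂(M.ρN a (out N ω))) atTop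
        (𝓝 (∫ x, ψ x ∂(M.ρ a))) := by
    rintro ψ hψ ⟨C, hC⟩
    have h := hcons.conv.ae_tendsto hout (hw.coe_nnreal_real.mul hψ) (B := W * C) fun x => by
      rw [Pi.mul_apply, abs_mul, abs_of_nonneg (NNReal.coe_nonneg _)]
      exact mul_le_mul (hW x) (hC x) (abs_nonneg _) W.coe_nonneg
    rw [hρ]
    simp only [DaCSMC.Model.ρN, integral_withDensity_eq_integral_smul hw, NNReal.smul_def,
      smul_eq_mul]
    exact h
  have hφlaw := law φ hφ hφb
  have hmass : ∀ᵐ ω ∂P, Tendsto (fun N => (M.ρN a (out N ω) Set.univ).toReal) atTop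
      (𝓝 (M.ρ a Set.univ).toReal) := by
    simpa [measureReal_def] using law (fun _ => 1) measurable_const ⟨1, fun _ => by simp⟩
  have hρne : M.ρ a ≠ 0 := by
    intro h0
    rw [hρ, withDensity_eq_zero_iff hw.coe_nnreal_ennreal.aemeasurable] at h0
    refine hcons.ne_zero (ae_eq_bot.1 (eventually_false_iff_eq_bot.1 ?_))
    filter_upwards [h0] with x hx
    simp [(h₁.pos a x).ne'] at hx
  have hZ : (M.ρ a Set.univ).toReal ≠ 0 :=
    ENNReal.toReal_ne_zero.2 ⟨Measure.measure_univ_ne_zero.2 hρne, measure_ne_top _ _⟩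
  refine ⟨hφlaw, ?_, ?_⟩
  · filter_upwards [hφlaw, hmass] with ω h1 h2
    simp only [DaCSMC.Model.μN, DaCSMC.Model.μ, DaCSMC.integral_normalize]
    exact (h2.inv₀ hZ).mul h1
  · filter_upwards [hmass] with ω h
    exact (ENNReal.tendsto_toReal_iff (fun N => measure_ne_top _ _) (measure_ne_top _ _)).1 h
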